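/- Let $U=\{z\in\mathbb C:|z|<1\}$. For $0<p<\infty$ the Hardy space $H^p$ is the set of analytic functions $f$ on $U$ with $\sup_{0<r<1}\frac1{2\pi}\int_0^{2\pi}|f(re^{it})|^p\,dt<\infty$; $H^2$ carries the inner product $\langle f,g\rangle=\lim_{r\to1^-}\frac1{2\pi}\int_0^{2\pi}f(re^{it})\overline{g(re^{it})}\,dt$. For $0<p<\infty$ and $\alpha>-1$ the weighted Bergman space $A^p_\alpha$ is the set of analytic functions $f$ on $U$ with $\frac1\pi\iint_U|f(z)|^p(1-|z|)^\alpha\,dA(z)<\infty$, where $dA$ is Lebesgue area measure. For $|\xi|=1$ and $\eta>1$ the Stolz domain $\Omega_\eta(\xi)$ is $\{z\in U:|1-\bar\xi z|\le\eta(1-|z|)\}$. Let $(a_n)$ be a finite or infinite sequence of complex numbers (repetitions allowed) with $0<|a_n|<1$ for all $n$ and $\sum_n(1-|a_n|)<\infty$, and let $$B(z)=\prod_n\frac{\bar a_n}{|a_n|}\,\frac{a_n-z}{1-\bar a_nz}\qquad(z\in U)$$ be the Blaschke product with zeros $(a_n)$. Suppose that there are $\xi$ with $|\xi|=1$ and $\eta>1$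 such that $a_n\in\Omega_\eta(\xi)$ for all $n$. If $\alpha>-1$ and $0<p<1+\frac23\alpha$, then $f'\in A^p_\alpha$ for every $f$ in the model space $H^2\ominus BH^2=\{f\in H^2:\langle f,Bg\rangle=0\text{ for all }g\in H^2\}$. -/

import Mathlib

open Set Filter Topology MeasureTheory ComplexConjugate
open scoped ENNReal

noncomputable section

/-- The open unit disc `U` of the complex plane. -/
def unitDisc : Set ℂ := Metric.ball 0 1

/-- The integral mean
`M_p(r; f) = ((1 / 2π) ∫₀^{2π} |f (r e^{it})|^p dt)^{1/p}`. -/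
def integralMean (p r : ℝ) (f : ℂ → ℂ) : ℝ :=
  (Real.circleAverage (fun z => ‖f z‖ ^ p) 0 r) ^ (1 / p)

/-- The Hardy space `H^p`: functions analytic in the unit disc whose integral means of order `p`
over the circles of radius `0 < r < 1` are bounded.  (Functions are total on `ℂ`, but only their
values in the unit disc matter.) -/
def hardySpace (p : ℝ) : Set (ℂ → ℂ) :=
  {f | DifferentiableOn ℂ f unitDisc ∧
    BddAbove ((fun r => integralMean p r f) '' Ioo (0 : ℝ) 1)}

/-- `HasHardyInner f g c`: the inner product `⟨f, g⟩` of `H²` exists and equals `c`, where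
`⟨f, g⟩ = lim_{r → 1⁻} (1 / 2π) ∫₀^{2π} f (r e^{it}) * conj (g (r e^{it})) dt`
(this is the inner product inducing the norm `‖f‖ = sup_{0<r<1} M_2(r; f)`). -/
def HasHardyInner (f g : ℂ → ℂ) (c : ℂ) : Prop :=
  Tendsto (fun r : ℝ => Real.circleAverage (fun z => f z * conj (g z)) 0 r) (𝓝[<] 1) (𝓝 c)

/-- The model space `(B H²)^⊥ = H² ⊖ B H²`. -/
def modelSpace (B : ℂ → ℂ) : Set (ℂ → ℂ) :=
  {f | f ∈ hardySpace 2 ∧ ∀ g ∈ hardySpace 2, HasHardyInner f (fun z => B z * g z) 0}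

/-- The norm of the weighted Bergman space `A^p_α`, with values in `[0, ∞]`:
`((1 / π) ∬_U |f z|^p (1 - |z|)^α dA(z))^{1/p}`. -/
def bergmanNorm (p α : ℝ) (f : ℂ → ℂ) : ℝ≥0∞ :=
  (ENNReal.ofReal (1 / Real.pi) *
    ∫⁻ z in unitDisc, ENNReal.ofReal (‖f z‖ ^ p * (1 - ‖z‖) ^ α)) ^ (1 / p)

/-- The weighted Bergman space `A^p_α`: functions analytic in the unit disc with finite norm. -/
def bergmanSpace (p α : ℝ) : Set (ℂ → ℂ) :=
  {f | DifferentiableOn ℂ f unitDisc ∧ bergmanNorm p α f < ∞}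

/-- The Blaschke factor `(conj a / |a|) (a - z) / (1 - conj a z)`. -/
def blaschkeFactor (a z : ℂ) : ℂ :=
  conj a / (‖a‖ : ℂ) * ((a - z) / (1 - conj a * z))

/-- `a` is the (finite or infinite) zero sequence, repeated by multiplicity, of a Blaschke
product: `0 < |a_i| < 1` for all `i`, and `∑ (1 - |a_i|) < ∞`. -/
def IsBlaschkeSequence {ι : Type*} (a : ι → ℂ) : Prop :=
  (∀ i, 0 < ‖a i‖ ∧ ‖a i‖ < 1) ∧ Summable fun i => 1 - ‖a i‖

/-- The Blaschke product with zeros `a`.  For a Blaschke sequence the product converges absolutely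
at each point of the unit disc, see `IsBlaschkeSequence.multipliable`. -/
def blaschkeProduct {ι : Type*} (a : ι → ℂ) (z : ℂ) : ℂ :=
  ∏' i, blaschkeFactor (a i) z

/-- The Stolz domain `Ω_η(ξ)` with vertex `ξ`. -/
def stolzDomain (η : ℝ) (ξ : ℂ) : Set ℂ :=
  {z | z ∈ unitDisc ∧ ‖1 - conj ξ * z‖ ≤ η * (1 - ‖z‖)}

/-- The estimate behind the convergence of Blaschke products. -/
theorem norm_blaschkeFactor_sub_one_le {a z : ℂ} (h0 : 0 < ‖a‖) (h1 : ‖a‖ < 1)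
    (hz : z ∈ unitDisc) :
    ‖blaschkeFactor a z - 1‖ ≤ 2 / (1 - ‖z‖) * (1 - ‖a‖) := by
  have hz1 : ‖z‖ < 1 := by simpa [unitDisc] using hz
  have hlow : 1 - ‖z‖ ≤ ‖1 - conj a * z‖ := by
    have h := norm_sub_norm_le (1 : ℂ) (conj a * z)
    rw [norm_one, norm_mul, RCLike.norm_conj] at h
    nlinarith [norm_nonneg z]
  have hpos : 0 < ‖1 - conj a * z‖ := by linarith
  have hden : (1 - conj a * z) ≠ 0 := norm_pos_iff.mp hpos
  have hna : (‖a‖ : ℂ) ≠ 0 := by exact_mod_cast h0.ne'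
  have haa : conj a * a = (‖a‖ : ℂ) ^ 2 := by
    rw [mul_comm, Complex.mul_conj, Complex.normSq_eq_norm_sq]; push_cast; ring
  have key : blaschkeFactor a z - 1
      = -((1 - ‖a‖ : ℝ) : ℂ) * (((‖a‖ : ℂ) + conj a * z) / (‖a‖ * (1 - conj a * z))) := by
    unfold blaschkeFactor
    field_simp
    push_cast
    linear_combination haa
  rw [key, norm_mul, norm_neg, Complex.norm_real, Real.norm_of_nonneg (by linarith), mul_comm]
  refine mul_le_mul_of_nonneg_right ?_ (by linarith)
  rw [norm_div, norm_mul, Complex.norm_real, norm_norm, div_le_div_iff₀ (by positivity) (by linarith)]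
  have hnum : ‖(‖a‖ : ℂ) + conj a * z‖ ≤ 2 * ‖a‖ := by
    refine (norm_add_le _ _).trans ?_
    rw [norm_mul, RCLike.norm_conj, Complex.norm_real, norm_norm]
    nlinarith
  calc _ ≤ (2 * ‖a‖) * (1 - ‖z‖) := mul_le_mul_of_nonneg_right hnum (by linarith)
    _ ≤ (2 * ‖a‖) * ‖1 - conj a * z‖ := mul_le_mul_of_nonneg_left hlow (by linarith)
    _ = _ := by ring

/-- The infinite product defining a Blaschke product converges in the unit disc. -/
theorem IsBlaschkeSequence.multipliable {ι : Type*} {a : ι → ℂ} (ha : IsBlaschkeSequence a)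
    {z : ℂ} (hz : z ∈ unitDisc) : Multipliable fun i => blaschkeFactor (a i) z := by
  have h : Summable fun i => ‖blaschkeFactor (a i) z - 1‖ :=
    Summable.of_nonneg_of_le (fun _ => norm_nonneg _)
      (fun i => norm_blaschkeFactor_sub_one_le (ha.1 i).1 (ha.1 i).2 hz) (ha.2.mul_left _)
  simpa using multipliable_one_add_of_summable h

end

/-!
Write `K_z = (1 - conj (B z) * B) / (1 - conj z * ·)`. For `f` in the model space of `B` the Cauchy
formula and orthogonality to `B H²` give `f z - f u = ⟨f, K_z - K_u⟩`, so that `f` is as smooth as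
the kernel: `|f z - f u|² ≤ ‖f‖² (K_z(z) - K_u(z) - K_z(u) + K_u(u))`
(`norm_combination_le_of_mem_modelSpace`; only `|B| ≤ 1` in the disc is needed, no boundary values).

For a finite Blaschke product this kernel distance is the sum of the squares `|E_n(z) - E_n(u)|²`
over the Takenaka–Malmquist basis (`kernelDistSq_modelKernel_insert`). The factors and the Szegő
kernels in `E_n` are Lipschitz with constants governed by `δ = inf |1 - conj a_n * z|`, whence
a bound by `(C |z - u| / δ³)²` that depends on the zeros only through `∑ (1 - |a_n|)` and so passes
to infinite products. If the zeros lie in a Stolz domain with vertex `ξ`, then `δ` is at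
least a constant times `d = |1 - conj ξ * z|`, and `|f' z| ≤ C d⁻³` (`norm_deriv_le_of_mem_stolzDomain`).

Besides, `|f' z| ≤ C h^(-3/2)` with `h = 1 - |z|`, as for every function in `H²`. A weighted
geometric mean of both bounds gives `|f'|^p h^α ≤ C d^(-s) h^(α - 3p/2 + s/2)` for `0 < s < 3p`.
In polar coordinates this is integrable if `s < 1` and `α - 3p/2 + s/2 > -1`, and such an `s` exists
exactly when `p < 1 + 2α/3` (given `α > -1`).
-/

/-! ### Szegő kernels and the Hardy inner product -/

/-- The Szegő kernel `w ↦ 1 / (1 - conj z * w)` of the unit disc. -/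
noncomputable def szegoKernel (z w : ℂ) : ℂ := (1 - conj z * w)⁻¹

/-- The kernel `(1 - conj (B z) * B w) / (1 - conj z * w)`, which reproduces the values at `z` of
the functions of the model space of an inner function `B`. -/
noncomputable def modelKernel (B : ℂ → ℂ) (z w : ℂ) : ℂ := (1 - conj (B z) * B w) * szegoKernel z w

theorem mem_unitDisc {z : ℂ} : z ∈ unitDisc ↔ ‖z‖ < 1 := by simp [unitDisc]

theorem one_sub_norm_le_norm_one_sub_conj_mul (z : ℂ) {w : ℂ} (hw : ‖w‖ ≤ 1) :
    1 - ‖z‖ ≤ ‖1 - conj z * w‖ := by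
  have h := norm_sub_norm_le (1 : ℂ) (conj z * w)
  rw [norm_one, norm_mul, RCLike.norm_conj] at h
  nlinarith [norm_nonneg z]

theorem one_sub_conj_mul_ne_zero {z w : ℂ} (hz : ‖z‖ < 1) (hw : ‖w‖ ≤ 1) :
    1 - conj z * w ≠ 0 :=
  norm_pos_iff.mp ((sub_pos.2 hz).trans_le (one_sub_norm_le_norm_one_sub_conj_mul z hw))

theorem differentiableOn_szegoKernel {z : ℂ} (hz : z ∈ unitDisc) :
    DifferentiableOn ℂ (szegoKernel z) unitDisc := by
  intro w hw
  refine DifferentiableAt.differentiableWithinAt ?_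
  unfold szegoKernel
  exact DifferentiableAt.inv (by fun_prop)
    (one_sub_conj_mul_ne_zero (mem_unitDisc.1 hz) (mem_unitDisc.1 hw).le)

theorem ContinuousOn.circleIntegrable_of_unitDisc {E : Type*} [NormedAddCommGroup E]
    {f : ℂ → E} (hf : ContinuousOn f unitDisc) {r : ℝ} (hr : r ∈ Ioo (0 : ℝ) 1) :
    CircleIntegrable f 0 r := by
  refine ContinuousOn.circleIntegrable hr.1.le (hf.mono fun z hz => ?_)
  rw [mem_unitDisc, mem_sphere_zero_iff_norm.1 hz]
  exact hr.2

theorem Ioo_mem_nhdsLT_one : Ioo (0 : ℝ) 1 ∈ 𝓝[<] (1 : ℝ) := Ioo_mem_nhdsLT zero_lt_one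

/-- The average against the Szegő kernel at radius `r` is the value at `r² z`, by Cauchy's formula:
on the circle `|w| = r` one has `conj w = r² / w`. -/
theorem circleAverage_mul_conj_szegoKernel {f : ℂ → ℂ} (hf : DifferentiableOn ℂ f unitDisc)
    {z : ℂ} (hz : z ∈ unitDisc) {r : ℝ} (hr : r ∈ Ioo (0 : ℝ) 1) :
    Real.circleAverage (fun w => f w * conj (szegoKernel z w)) 0 r = f (r ^ 2 * z) := by
  have hz' := mem_unitDisc.1 hz
  have hmem : (r : ℂ) ^ 2 * z ∈ Metric.ball (0 : ℂ) |r| := by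
    rw [abs_of_pos hr.1, mem_ball_zero_iff, norm_mul, norm_pow, Complex.norm_real,
      Real.norm_of_nonneg hr.1.le]
    nlinarith [hr.1, hr.2, norm_nonneg z, mul_pos hr.1 hr.1]
  have hd : DiffContOnCl ℂ f (Metric.ball (0 : ℂ) |r|) := by
    refine DifferentiableOn.diffContOnCl (hf.mono ?_)
    refine Metric.closure_ball_subset_closedBall.trans fun w hw => ?_
    rw [mem_unitDisc]
    rw [mem_closedBall_zero_iff, abs_of_pos hr.1] at hw
    exact hw.trans_lt hr.2
  rw [← hd.circleAverage_smul_div hmem]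
  refine Real.circleAverage_congr_sphere fun w hw => ?_
  rw [mem_sphere_zero_iff_norm, abs_of_pos hr.1] at hw
  have hww : w * conj w = (r : ℂ) ^ 2 := by
    rw [Complex.mul_conj, Complex.normSq_eq_norm_sq, hw]; push_cast; ring
  have hw0 : w ≠ 0 := norm_pos_iff.1 (hw ▸ hr.1)
  have h1 : 1 - z * conj w ≠ 0 := by
    have h := one_sub_conj_mul_ne_zero (z := z) (w := w) hz' (hw ▸ hr.2.le)
    intro h0
    apply h
    have := congrArg conj h0
    simpa using this
  have h2 : w - 0 - 0 = w * 1 := by ring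
  have h3 : w - (r : ℂ) ^ 2 * z = w * (1 - z * conj w) := by linear_combination (z) * hww
  simp only [szegoKernel, sub_zero, smul_eq_mul, map_inv₀, map_sub, map_mul, map_one,
    Complex.conj_conj]
  rw [h3]
  field_simp

/-- Reproducing property of linear combinations of two Szegő kernels. -/
theorem hasHardyInner_szegoKernel {f : ℂ → ℂ} (hf : DifferentiableOn ℂ f unitDisc)
    {z u : ℂ} (hz : z ∈ unitDisc) (hu : u ∈ unitDisc) (c d : ℂ) :
    HasHardyInner f (fun w => c * szegoKernel z w + d * szegoKernel u w)
      (conj c * f z + conj d * f u) := by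
  have hlim : ∀ v ∈ unitDisc, Tendsto (fun r : ℝ => f (r ^ 2 * v)) (𝓝[<] 1) (𝓝 (f v)) := by
    intro v hv
    have h1 : ContinuousAt f v :=
      (hf.differentiableAt (Metric.isOpen_ball.mem_nhds hv)).continuousAt
    have h2 : Tendsto (fun r : ℝ => (r : ℂ) ^ 2 * v) (𝓝[<] 1) (𝓝 v) := by
      have : Continuous fun r : ℝ => (r : ℂ) ^ 2 * v := by fun_prop
      exact (this.tendsto' 1 v (by simp)).mono_left nhdsWithin_le_nhds
    exact h1.tendsto.comp h2
  refine (((hlim z hz).const_mul (conj c)).add ((hlim u hu).const_mul (conj d))).congr' ?_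
  filter_upwards [Ioo_mem_nhdsLT_one] with r hr
  have hint : ∀ v ∈ unitDisc, ∀ e : ℂ,
      CircleIntegrable (fun w => e • (f w * conj (szegoKernel v w))) 0 r := fun v hv e =>
    ContinuousOn.circleIntegrable_of_unitDisc ((hf.continuousOn.mul
      (Complex.continuous_conj.comp_continuousOn
        (differentiableOn_szegoKernel hv).continuousOn)).const_smul e) hr
  rw [← circleAverage_mul_conj_szegoKernel hf hz hr, ← circleAverage_mul_conj_szegoKernel hf hu hr,
    ← smul_eq_mul, ← smul_eq_mul (conj d), ← Real.circleAverage_fun_smul,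
    ← Real.circleAverage_fun_smul, ← Real.circleAverage_fun_add (hint z hz _) (hint u hu _)]
  congr 1
  funext w
  simp only [map_add, map_mul, smul_eq_mul]
  ring

theorem HasHardyInner.add {f₁ f₂ g₁ g₂ : ℂ → ℂ} {a b : ℂ} (h₁ : HasHardyInner f₁ g₁ a)
    (h₂ : HasHardyInner f₂ g₂ b) (c₁ : ContinuousOn (fun w => f₁ w * conj (g₁ w)) unitDisc)
    (c₂ : ContinuousOn (fun w => f₂ w * conj (g₂ w)) unitDisc) :
    Tendsto (fun r : ℝ => Real.circleAverage
      (fun w => f₁ w * conj (g₁ w) + f₂ w * conj (g₂ w)) 0 r) (𝓝[<] 1) (𝓝 (a + b)) := by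
  refine (Tendsto.add h₁ h₂).congr' ?_
  filter_upwards [Ioo_mem_nhdsLT_one] with r hr
  exact (Real.circleAverage_fun_add (c₁.circleIntegrable_of_unitDisc hr)
    (c₂.circleIntegrable_of_unitDisc hr)).symm

/-- Cauchy–Schwarz for the Hardy inner product, where the second function is controlled by the
limit of the averages of a majorant `H` of its squared modulus. -/
theorem norm_le_of_hasHardyInner {f F H : ℂ → ℂ} {c S : ℂ} {M A : ℝ} (hM : 0 < M) (hA : 0 < A)
    (hf : ContinuousOn f unitDisc) (hF : ContinuousOn F unitDisc) (hH : ContinuousOn H unitDisc)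
    (hfM : ∀ r ∈ Ioo (0 : ℝ) 1, Real.circleAverage (fun z => ‖f z‖ ^ 2) 0 r ≤ M ^ 2)
    (hFH : ∀ w ∈ unitDisc, ‖F w‖ ^ 2 ≤ (H w).re)
    (hS : Tendsto (fun r : ℝ => Real.circleAverage H 0 r) (𝓝[<] 1) (𝓝 S))
    (hSA : S.re ≤ A ^ 2) (hc : HasHardyInner f F c) : ‖c‖ ≤ M * A := by
  -- `2 |f F| ≤ t |f|² + |F|² / t`, with the optimal `t = A / M`
  set t := A / M with ht
  have htp : 0 < t := div_pos hA hM
  have hbound : ∀ᶠ r : ℝ in 𝓝[<] 1, ‖Real.circleAverage (fun z => f z * conj (F z)) 0 r‖ ≤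
      t / 2 * M ^ 2 + (2 * t)⁻¹ * (Real.circleAverage H 0 r).re := by
    filter_upwards [Ioo_mem_nhdsLT_one] with r hr
    have hnorm : ‖Real.circleAverage (fun z => f z * conj (F z)) 0 r‖ ≤
        Real.circleAverage (fun z => ‖f z * conj (F z)‖) 0 r := by
      unfold Real.circleAverage
      rw [norm_smul, Real.norm_of_nonneg (by positivity), smul_eq_mul]
      gcongr
      exact intervalIntegral.norm_integral_le_integral_norm Real.two_pi_pos.le
    have hre : Real.circleAverage (fun z => (H z).re) 0 r = (Real.circleAverage H 0 r).re :=
      Complex.reCLM.circleAverage_comp_comm (hH.circleIntegrable_of_unitDisc hr)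
    have i1 : ContinuousOn (fun z => ‖f z * conj (F z)‖) unitDisc :=
      (hf.mul (Complex.continuous_conj.comp_continuousOn hF)).norm
    have i2 : ContinuousOn (fun z => (t / 2) • ‖f z‖ ^ 2) unitDisc :=
      (hf.norm.pow 2).const_smul (t / 2)
    have i3 : ContinuousOn (fun z => (2 * t)⁻¹ • (H z).re) unitDisc :=
      (Complex.continuous_re.comp_continuousOn hH).const_smul (2 * t)⁻¹
    have hmono : Real.circleAverage (fun z => ‖f z * conj (F z)‖) 0 r ≤
        Real.circleAverage (fun z => (t / 2) • ‖f z‖ ^ 2 + (2 * t)⁻¹ • (H z).re) 0 r := by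
      refine Real.circleAverage_mono (i1.circleIntegrable_of_unitDisc hr)
        ((i2.add i3).circleIntegrable_of_unitDisc hr) fun w hw => ?_
      rw [mem_sphere_zero_iff_norm, abs_of_pos hr.1] at hw
      have h1 := hFH w (mem_unitDisc.2 (hw ▸ hr.2))
      rw [norm_mul, RCLike.norm_conj, smul_eq_mul, smul_eq_mul]
      have h2 : ‖f w‖ * ‖F w‖ ≤ t / 2 * ‖f w‖ ^ 2 + (2 * t)⁻¹ * ‖F w‖ ^ 2 := by
        have h3 : t / 2 * ‖f w‖ ^ 2 + (2 * t)⁻¹ * ‖F w‖ ^ 2 - ‖f w‖ * ‖F w‖ =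
            (2 * t)⁻¹ * (t * ‖f w‖ - ‖F w‖) ^ 2 := by
          field_simp
          ring
        nlinarith [mul_nonneg (inv_nonneg.2 (mul_pos two_pos htp).le)
          (sq_nonneg (t * ‖f w‖ - ‖F w‖))]
      exact h2.trans (by gcongr)
    refine hnorm.trans (hmono.trans ?_)
    rw [Real.circleAverage_fun_add (i2.circleIntegrable_of_unitDisc hr)
      (i3.circleIntegrable_of_unitDisc hr), Real.circleAverage_fun_smul,
      Real.circleAverage_fun_smul, hre, smul_eq_mul, smul_eq_mul]
    gcongr
    exact hfM r hr
  have hlim := le_of_tendsto_of_tendsto hc.norm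
    ((((Complex.continuous_re.tendsto S).comp hS).const_mul (2 * t)⁻¹).const_add
      (t / 2 * M ^ 2)) hbound
  refine hlim.trans ?_
  calc t / 2 * M ^ 2 + (2 * t)⁻¹ * S.re ≤ t / 2 * M ^ 2 + (2 * t)⁻¹ * A ^ 2 := by gcongr
    _ = M * A := by rw [ht]; field_simp; ring

theorem exists_circleAverage_sq_le {f : ℂ → ℂ} (hf : f ∈ hardySpace 2) :
    ∃ M : ℝ, 0 < M ∧
      ∀ r ∈ Ioo (0 : ℝ) 1, Real.circleAverage (fun z => ‖f z‖ ^ 2) 0 r ≤ M ^ 2 := by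
  obtain ⟨K, hK⟩ := hf.2
  refine ⟨max K 1, by positivity, fun r hr => ?_⟩
  have h := hK (mem_image_of_mem _ hr)
  simp only [integralMean, Real.rpow_two] at h
  have h0 : 0 ≤ Real.circleAverage (fun z => ‖f z‖ ^ 2) 0 r :=
    Real.circleAverage_nonneg_of_nonneg fun _ _ => by positivity
  rw [← Real.sqrt_eq_rpow] at h
  calc _ = Real.sqrt (Real.circleAverage (fun z => ‖f z‖ ^ 2) 0 r) ^ 2 := (Real.sq_sqrt h0).symm
    _ ≤ _ := by gcongr; exact h.trans (le_max_left _ _)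

theorem mem_hardySpace_two_of_bounded {f : ℂ → ℂ} (hf : DifferentiableOn ℂ f unitDisc) {K : ℝ}
    (hK : ∀ w ∈ unitDisc, ‖f w‖ ≤ K) : f ∈ hardySpace 2 := by
  refine ⟨hf, ⟨(K ^ 2) ^ (1 / 2 : ℝ), ?_⟩⟩
  rintro _ ⟨r, hr, rfl⟩
  simp only [integralMean, Real.rpow_two]
  refine Real.rpow_le_rpow (Real.circleAverage_nonneg_of_nonneg fun _ _ => by positivity) ?_
    (by norm_num)
  refine Real.circleAverage_mono_on_of_le_circle
    ((hf.continuousOn.norm.pow 2).circleIntegrable_of_unitDisc hr) fun w hw => ?_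
  rw [mem_sphere_zero_iff_norm, abs_of_pos hr.1] at hw
  have := hK w (mem_unitDisc.2 (hw ▸ hr.2))
  gcongr

theorem norm_szegoKernel_le {z w : ℂ} (hz : z ∈ unitDisc) (hw : w ∈ unitDisc) :
    ‖szegoKernel z w‖ ≤ (1 - ‖z‖)⁻¹ := by
  rw [szegoKernel, norm_inv]
  exact inv_anti₀ (sub_pos.2 (mem_unitDisc.1 hz))
    (one_sub_norm_le_norm_one_sub_conj_mul z (mem_unitDisc.1 hw).le)

/-! ### Point evaluations on model spaces -/

/-- Point evaluations on the model space of a contraction `B` are bounded by the model kernel.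
The function `c K_z + d K_u`, with `K` the model kernel, differs from the same combination `G` of
Szegő kernels by `B g` with `g ∈ H²`, so it represents the same functional on the model space;
as `|B| ≤ 1`, its squared norm is at most `⟨G, G⟩ - 2 Re ⟨B g, G⟩ + ⟨g, g⟩`. -/
theorem norm_combination_le_of_mem_modelSpace {B f : ℂ → ℂ} (hB : DifferentiableOn ℂ B unitDisc)
    (hB1 : ∀ w ∈ unitDisc, ‖B w‖ ≤ 1) (hf : f ∈ modelSpace B) {M A : ℝ} (hM : 0 < M)
    (hA : 0 < A)
    (hfM : ∀ r ∈ Ioo (0 : ℝ) 1, Real.circleAverage (fun z => ‖f z‖ ^ 2) 0 r ≤ M ^ 2)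
    {z u : ℂ} (hz : z ∈ unitDisc) (hu : u ∈ unitDisc) (c d : ℂ)
    (hSA : (conj c * (c * modelKernel B z z + d * modelKernel B u z) +
      conj d * (c * modelKernel B z u + d * modelKernel B u u)).re ≤ A ^ 2) :
    ‖conj c * f z + conj d * f u‖ ≤ M * A := by
  set G : ℂ → ℂ := fun w => c * szegoKernel z w + d * szegoKernel u w with hG
  set g : ℂ → ℂ := fun w =>
    (c * conj (B z)) * szegoKernel z w + (d * conj (B u)) * szegoKernel u w with hg
  have dz := differentiableOn_szegoKernel hz
  have du := differentiableOn_szegoKernel hu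
  have dG : DifferentiableOn ℂ G unitDisc := (dz.const_mul c).add (du.const_mul d)
  have dg : DifferentiableOn ℂ g unitDisc := (dz.const_mul _).add (du.const_mul _)
  have dBg : DifferentiableOn ℂ (fun w => B w * g w) unitDisc := hB.mul dg
  have hgH : g ∈ hardySpace 2 := by
    refine mem_hardySpace_two_of_bounded dg
      (K := ‖c * conj (B z)‖ * (1 - ‖z‖)⁻¹ + ‖d * conj (B u)‖ * (1 - ‖u‖)⁻¹) fun w hw => ?_
    refine (norm_add_le _ _).trans ?_
    rw [norm_mul _ (szegoKernel z w), norm_mul _ (szegoKernel u w)]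
    gcongr
    · exact norm_szegoKernel_le hz hw
    · exact norm_szegoKernel_le hu hw
  have cont_conj : ∀ {φ : ℂ → ℂ}, DifferentiableOn ℂ φ unitDisc →
      ContinuousOn (fun w => conj (φ w)) unitDisc := fun h =>
    Complex.continuous_conj.comp_continuousOn h.continuousOn
  have hfc := hf.1.1.continuousOn
  have hfG : HasHardyInner f (fun w => G w - B w * g w) (conj c * f z + conj d * f u) := by
    have h1 := hasHardyInner_szegoKernel hf.1.1 hz hu c d
    have h2 := hf.2 g hgH
    have h3 : HasHardyInner f (fun w => -(B w * g w)) 0 := by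
      have := Tendsto.neg h2
      rw [neg_zero] at this
      refine this.congr fun r => ?_
      rw [← neg_one_smul ℝ, ← Real.circleAverage_fun_smul]
      congr 1
      funext w
      simp
    have h4 := h1.add h3 (hfc.mul (cont_conj dG)) (hfc.mul (cont_conj dBg.neg))
    rw [add_zero] at h4
    refine h4.congr fun r => ?_
    congr 1
    funext w
    simp only [map_sub, map_neg]
    ring
  have d2 : DifferentiableOn ℂ (fun w => G w - 2 * (B w * g w)) unitDisc :=
    dG.sub (dBg.const_mul 2)
  have k1 := hasHardyInner_szegoKernel d2 hz hu c d
  have k2 := hasHardyInner_szegoKernel dg hz hu (c * conj (B z)) (d * conj (B u))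
  have c1 := d2.continuousOn.mul (cont_conj dG)
  have c2 := dg.continuousOn.mul (cont_conj dg)
  refine norm_le_of_hasHardyInner hM hA hfc (dG.sub dBg).continuousOn (c1.add c2) hfM ?_
    (k1.add k2 c1 c2) ?_ hfG
  · intro w hw
    have e1 : ∀ v : ℂ, ((‖v‖ ^ 2 : ℝ) : ℂ) = v * conj v := fun v => by
      rw [Complex.mul_conj, Complex.normSq_eq_norm_sq]
    have e2 : (‖G w - B w * g w‖ ^ 2 : ℝ) =
        ((G w - 2 * (B w * g w)) * conj (G w)).re + ‖B w * g w‖ ^ 2 := by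
      rw [← Complex.normSq_eq_norm_sq, Complex.normSq_sub, ← Complex.normSq_eq_norm_sq,
        sub_mul, Complex.sub_re, Complex.mul_conj, Complex.ofReal_re]
      have : (2 * (B w * g w) * conj (G w)).re = 2 * (G w * conj (B w * g w)).re := by
        have e : conj (G w * conj (B w * g w)) = B w * g w * conj (G w) := by simp; ring
        rw [mul_assoc, ← e, ← Complex.conj_re (G w * conj (B w * g w))]
        simp
      rw [this]; ring
    have e3 : (g w * conj (g w)).re = ‖g w‖ ^ 2 := by
      rw [← e1, Complex.ofReal_re]
    change ‖G w - B w * g w‖ ^ 2 ≤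
      ((G w - 2 * (B w * g w)) * conj (G w) + g w * conj (g w)).re
    rw [Complex.add_re, e2, e3]
    have h1 : ‖B w * g w‖ ≤ ‖g w‖ := by
      rw [norm_mul]
      exact mul_le_of_le_one_left (norm_nonneg _) (hB1 w hw)
    gcongr
  · refine le_of_eq_of_le ?_ hSA
    congr 1
    simp only [hG, hg, modelKernel, map_mul, Complex.conj_conj]
    ring

/-- Functions in a model space satisfy the growth estimate of `H²`. -/
theorem norm_le_of_mem_modelSpace {B f : ℂ → ℂ} (hB : DifferentiableOn ℂ B unitDisc)
    (hB1 : ∀ w ∈ unitDisc, ‖B w‖ ≤ 1) (hf : f ∈ modelSpace B) {M : ℝ} (hM : 0 < M)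
    (hfM : ∀ r ∈ Ioo (0 : ℝ) 1, Real.circleAverage (fun z => ‖f z‖ ^ 2) 0 r ≤ M ^ 2)
    {z : ℂ} (hz : z ∈ unitDisc) : ‖f z‖ ≤ M * (1 - ‖z‖) ^ (-(1 / 2) : ℝ) := by
  have hz' := mem_unitDisc.1 hz
  have hpos : 0 < 1 - ‖z‖ := sub_pos.2 hz'
  have e1 : ∀ v : ℂ, conj v * v = ((‖v‖ ^ 2 : ℝ) : ℂ) := fun v => by
    rw [mul_comm, Complex.mul_conj, Complex.normSq_eq_norm_sq]
  have h := norm_combination_le_of_mem_modelSpace hB hB1 hf hM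
    (Real.rpow_pos_of_pos hpos (-(1 / 2) : ℝ)) hfM hz hz 1 0 ?_
  · simpa using h
  · rw [← Real.rpow_natCast, ← Real.rpow_mul hpos.le]
    have e2 : modelKernel B z z = (((1 - ‖B z‖ ^ 2) * (1 - ‖z‖ ^ 2)⁻¹ : ℝ) : ℂ) := by
      rw [modelKernel, szegoKernel, e1, e1]
      push_cast
      ring
    simp only [map_one, map_zero, one_mul, zero_mul, add_zero, e2, Complex.ofReal_re]
    norm_num
    rw [Real.rpow_neg_one]
    have h1 : (1 - ‖z‖ ^ 2)⁻¹ ≤ (1 - ‖z‖)⁻¹ :=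
      inv_anti₀ hpos (by nlinarith [norm_nonneg z])
    have h2 : 0 ≤ (1 - ‖z‖ ^ 2)⁻¹ := inv_nonneg.2 (by nlinarith [norm_nonneg z])
    nlinarith [sq_nonneg ‖B z‖, mul_nonneg (sq_nonneg ‖B z‖) h2]

/-- Cauchy's estimate on the disc of half the distance to the unit circle. -/
theorem norm_deriv_le_of_norm_le_rpow {f : ℂ → ℂ} (hf : DifferentiableOn ℂ f unitDisc) {M : ℝ}
    (hM : 0 < M) (hfM : ∀ z ∈ unitDisc, ‖f z‖ ≤ M * (1 - ‖z‖) ^ (-(1 / 2) : ℝ))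
    {z : ℂ} (hz : z ∈ unitDisc) :
    ‖deriv f z‖ ≤ 4 * M * (1 - ‖z‖) ^ (-(3 / 2) : ℝ) := by
  have hpos : 0 < 1 - ‖z‖ := sub_pos.2 (mem_unitDisc.1 hz)
  set h := 1 - ‖z‖ with hh
  have hsub : ∀ w ∈ Metric.closedBall z (h / 2), h / 2 ≤ 1 - ‖w‖ := fun w hw => by
    have h1 := norm_sub_norm_le w z
    rw [← dist_eq_norm] at h1
    have h2 := Metric.mem_closedBall.1 hw
    linarith
  have hd : DiffContOnCl ℂ f (Metric.ball z (h / 2)) := by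
    refine DifferentiableOn.diffContOnCl (hf.mono ?_)
    refine Metric.closure_ball_subset_closedBall.trans fun w hw => ?_
    have := hsub w hw
    rw [mem_unitDisc]
    linarith
  have hC : ∀ w ∈ Metric.sphere z (h / 2), ‖f w‖ ≤ M * (h / 2) ^ (-(1 / 2) : ℝ) := fun w hw => by
    have h1 := hsub w (Metric.sphere_subset_closedBall hw)
    refine (hfM w (by rw [mem_unitDisc]; linarith)).trans ?_
    exact mul_le_mul_of_nonneg_left
      (Real.rpow_le_rpow_of_nonpos (by positivity) h1 (by norm_num)) hM.le
  refine (Complex.norm_deriv_le_of_forall_mem_sphere_norm_le (by positivity) hd hC).trans ?_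
  have h1 : M * (h / 2) ^ (-(1 / 2) : ℝ) / (h / 2) = M * (h / 2) ^ (-(3 / 2) : ℝ) := by
    have : (-(3 / 2) : ℝ) = -(1 / 2) - 1 := by norm_num
    rw [this, Real.rpow_sub_one (by positivity), mul_div_assoc]
  have h2 : (2 : ℝ) ^ (3 / 2 : ℝ) ≤ 4 := by
    calc (2 : ℝ) ^ (3 / 2 : ℝ) ≤ 2 ^ (2 : ℝ) :=
          Real.rpow_le_rpow_of_exponent_le one_le_two (by norm_num)
      _ = 4 := by norm_num
  have h3 : (h / 2) ^ (-(3 / 2) : ℝ) = 2 ^ (3 / 2 : ℝ) * h ^ (-(3 / 2) : ℝ) := by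
    rw [Real.div_rpow hpos.le two_pos.le, Real.rpow_neg two_pos.le, div_inv_eq_mul, mul_comm]
  rw [h1, h3]
  have := Real.rpow_pos_of_pos hpos (-(3 / 2) : ℝ)
  calc M * (2 ^ (3 / 2 : ℝ) * h ^ (-(3 / 2) : ℝ)) ≤ M * (4 * h ^ (-(3 / 2) : ℝ)) := by gcongr
    _ = _ := by ring

/-! ### Blaschke factors -/

theorem one_sub_conj_blaschkeFactor_mul {a z w : ℂ} (h0 : 0 < ‖a‖) (h1 : ‖a‖ < 1)
    (hz : z ∈ unitDisc) (hw : w ∈ unitDisc) :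
    1 - conj (blaschkeFactor a z) * blaschkeFactor a w =
      (1 - conj z * w) * ((1 - ‖a‖ ^ 2 : ℝ) * (conj (szegoKernel a z) * szegoKernel a w)) := by
  have hna : (‖a‖ : ℂ) ≠ 0 := by exact_mod_cast h0.ne'
  have haa : conj a * a = (‖a‖ : ℂ) ^ 2 := by
    rw [mul_comm, Complex.mul_conj, Complex.normSq_eq_norm_sq]; push_cast; ring
  have hw1 := one_sub_conj_mul_ne_zero h1 (mem_unitDisc.1 hw).le
  have hz1 : 1 - a * conj z ≠ 0 := by
    intro h
    apply one_sub_conj_mul_ne_zero h1 (mem_unitDisc.1 hz).le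
    simpa using congrArg conj h
  have hz2 : 1 - conj z * a ≠ 0 := by rwa [mul_comm]
  simp only [blaschkeFactor, szegoKernel, map_mul, map_div₀, map_sub, map_one, map_inv₀,
    Complex.conj_conj, Complex.conj_ofReal]
  push_cast
  rw [← haa]
  have hsq : (a / (‖a‖ : ℂ)) * (conj a / (‖a‖ : ℂ)) = 1 := by
    field_simp
    linear_combination haa
  have : a / (‖a‖ : ℂ) * ((conj a - conj z) / (1 - a * conj z)) *
      (conj a / (‖a‖ : ℂ) * ((a - w) / (1 - conj a * w))) =
      ((conj a - conj z) / (1 - a * conj z)) * ((a - w) / (1 - conj a * w)) := by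
    linear_combination ((conj a - conj z) / (1 - a * conj z)) * ((a - w) / (1 - conj a * w)) * hsq
  rw [this]
  field_simp
  ring

theorem norm_blaschkeFactor_le_one {a z : ℂ} (h0 : 0 < ‖a‖) (h1 : ‖a‖ < 1)
    (hz : z ∈ unitDisc) : ‖blaschkeFactor a z‖ ≤ 1 := by
  have h := one_sub_conj_blaschkeFactor_mul h0 h1 hz hz
  have e1 : ∀ v : ℂ, conj v * v = ((‖v‖ ^ 2 : ℝ) : ℂ) := fun v => by
    rw [mul_comm, Complex.mul_conj, Complex.normSq_eq_norm_sq]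
  rw [e1, e1, e1] at h
  have h' : 1 - ‖blaschkeFactor a z‖ ^ 2 =
      (1 - ‖z‖ ^ 2) * ((1 - ‖a‖ ^ 2) * ‖szegoKernel a z‖ ^ 2) := by exact_mod_cast h
  have hz2 : 0 ≤ 1 - ‖z‖ ^ 2 := by nlinarith [mem_unitDisc.1 hz, norm_nonneg z]
  have ha2 : 0 ≤ 1 - ‖a‖ ^ 2 := by nlinarith
  have : 0 ≤ (1 - ‖z‖ ^ 2) * ((1 - ‖a‖ ^ 2) * ‖szegoKernel a z‖ ^ 2) := by positivity
  exact (sq_le_one_iff₀ (norm_nonneg _)).1 (by linarith)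

theorem norm_szegoKernel_sub_le {a z u : ℂ} (h1 : ‖a‖ < 1) {δ : ℝ} (hδ : 0 < δ)
    (hz : δ ≤ ‖1 - conj a * z‖) (hu : δ ≤ ‖1 - conj a * u‖) :
    ‖szegoKernel a z - szegoKernel a u‖ ≤ ‖z - u‖ / δ ^ 2 := by
  have hz0 : 1 - conj a * z ≠ 0 := norm_pos_iff.1 (hδ.trans_le hz)
  have hu0 : 1 - conj a * u ≠ 0 := norm_pos_iff.1 (hδ.trans_le hu)
  have : szegoKernel a z - szegoKernel a u =
      conj a * (z - u) / ((1 - conj a * z) * (1 - conj a * u)) := by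
    unfold szegoKernel
    field_simp
    ring
  rw [this, norm_div, norm_mul, norm_mul, RCLike.norm_conj, sq]
  gcongr
  exact mul_le_of_le_one_left (norm_nonneg _) h1.le

theorem norm_blaschkeFactor_sub_le {a z u : ℂ} (h0 : 0 < ‖a‖) (h1 : ‖a‖ < 1) {δ : ℝ}
    (hδ : 0 < δ) (hz : δ ≤ ‖1 - conj a * z‖) (hu : δ ≤ ‖1 - conj a * u‖) :
    ‖blaschkeFactor a z - blaschkeFactor a u‖ ≤ 2 * (1 - ‖a‖) * ‖z - u‖ / δ ^ 2 := by
  have hz0 : 1 - conj a * z ≠ 0 := norm_pos_iff.1 (hδ.trans_le hz)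
  have hu0 : 1 - conj a * u ≠ 0 := norm_pos_iff.1 (hδ.trans_le hu)
  have haa : conj a * a = (‖a‖ : ℂ) ^ 2 := by
    rw [mul_comm, Complex.mul_conj, Complex.normSq_eq_norm_sq]; push_cast; ring
  have : blaschkeFactor a z - blaschkeFactor a u = -(conj a / (‖a‖ : ℂ)) *
      (((1 - ‖a‖ ^ 2 : ℝ) * (z - u)) / ((1 - conj a * z) * (1 - conj a * u))) := by
    unfold blaschkeFactor
    push_cast
    rw [← haa]
    have hz1 : 1 - z * conj a ≠ 0 := by rwa [mul_comm]
    have hu1 : 1 - u * conj a ≠ 0 := by rwa [mul_comm]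
    have : (a - z) / (1 - conj a * z) - (a - u) / (1 - conj a * u) =
        -((1 - conj a * a) * (z - u) / ((1 - conj a * z) * (1 - conj a * u))) := by
      field_simp
      ring
    linear_combination (conj a / (‖a‖ : ℂ)) * this
  have hu1 : ‖-(conj a / (‖a‖ : ℂ))‖ = 1 := by
    rw [norm_neg, norm_div, RCLike.norm_conj, Complex.norm_real, norm_norm, div_self h0.ne']
  rw [this, norm_mul, hu1, one_mul, norm_div, norm_mul, norm_mul, Complex.norm_real, sq δ,
    Real.norm_of_nonneg (by nlinarith)]
  gcongr
  nlinarith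

/-- Telescoping estimate for products of factors bounded by `1`. -/
theorem norm_prod_sub_prod_le {ι : Type*} (s : Finset ι) (x y : ι → ℂ) (hx : ∀ i, ‖x i‖ ≤ 1)
    (hy : ∀ i, ‖y i‖ ≤ 1) : ‖∏ i ∈ s, x i - ∏ i ∈ s, y i‖ ≤ ∑ i ∈ s, ‖x i - y i‖ := by
  classical
  induction s using Finset.induction_on with
  | empty => simp
  | insert i s hi ih =>
    rw [Finset.prod_insert hi, Finset.prod_insert hi, Finset.sum_insert hi]
    have h1 : ‖∏ j ∈ s, x j‖ ≤ 1 := by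
      rw [norm_prod]
      exact Finset.prod_le_one (fun _ _ => norm_nonneg _) fun j _ => hx j
    calc ‖x i * ∏ j ∈ s, x j - y i * ∏ j ∈ s, y j‖
        = ‖(x i - y i) * ∏ j ∈ s, x j + y i * (∏ j ∈ s, x j - ∏ j ∈ s, y j)‖ := by
          congr 1; ring
      _ ≤ ‖x i - y i‖ * ‖∏ j ∈ s, x j‖ + ‖y i‖ * ‖∏ j ∈ s, x j - ∏ j ∈ s, y j‖ := by
          refine (norm_add_le _ _).trans ?_
          rw [norm_mul, norm_mul]
      _ ≤ ‖x i - y i‖ * 1 + 1 * ∑ j ∈ s, ‖x j - y j‖ := by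
          gcongr
          exact hy i
      _ = _ := by ring

/-! ### Kernels of Blaschke products -/

/-- The finite Blaschke product with zeros `a i`, `i ∈ s`. -/
noncomputable def finiteBlaschke {ι : Type*} (a : ι → ℂ) (s : Finset ι) (z : ℂ) : ℂ :=
  ∏ i ∈ s, blaschkeFactor (a i) z

/-- The squared distance `‖K_z - K_u‖²` of two reproducing kernels, in terms of the kernel. -/
noncomputable def kernelDistSq (K : ℂ → ℂ → ℂ) (z u : ℂ) : ℝ := (K z z - K u z - K z u + K u u).re

/-- Adding a zero to a finite Blaschke product adds a square to the kernel distance. This is the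
expansion of the kernel in the Takenaka–Malmquist basis, whose elements are
`√(1 - |a|²) * B * szegoKernel a` with `B` the product over the earlier zeros. -/
theorem kernelDistSq_modelKernel_insert {ι : Type*} [DecidableEq ι] {a : ι → ℂ} {i : ι}
    (h0 : 0 < ‖a i‖) (h1 : ‖a i‖ < 1) {s : Finset ι} (hi : i ∉ s) {z u : ℂ}
    (hz : z ∈ unitDisc) (hu : u ∈ unitDisc) :
    kernelDistSq (modelKernel (finiteBlaschke a (insert i s))) z u =
      kernelDistSq (modelKernel (finiteBlaschke a s)) z u + (1 - ‖a i‖ ^ 2) *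
        ‖finiteBlaschke a s z * szegoKernel (a i) z -
          finiteBlaschke a s u * szegoKernel (a i) u‖ ^ 2 := by
  have key : ∀ v ∈ unitDisc, ∀ w ∈ unitDisc, modelKernel (finiteBlaschke a (insert i s)) v w =
      modelKernel (finiteBlaschke a s) v w + (1 - ‖a i‖ ^ 2 : ℝ) *
        (conj (finiteBlaschke a s v * szegoKernel (a i) v) *
          (finiteBlaschke a s w * szegoKernel (a i) w)) := by
    intro v hv w hw
    have hvw := one_sub_conj_mul_ne_zero (mem_unitDisc.1 hv) (mem_unitDisc.1 hw).le
    have h := one_sub_conj_blaschkeFactor_mul h0 h1 hv hw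
    have hs : (1 - conj v * w) * szegoKernel v w = 1 := mul_inv_cancel₀ hvw
    have hins : ∀ x, finiteBlaschke a (insert i s) x =
        blaschkeFactor (a i) x * finiteBlaschke a s x := fun x => Finset.prod_insert hi
    rw [modelKernel, modelKernel, hins, hins]
    simp only [map_mul]
    linear_combination (conj (finiteBlaschke a s v) * finiteBlaschke a s w) *
      (szegoKernel v w * h + (1 - ‖a i‖ ^ 2 : ℝ) *
        (conj (szegoKernel (a i) v) * szegoKernel (a i) w) * hs)
  set φ : ℂ → ℂ := fun w => finiteBlaschke a s w * szegoKernel (a i) w with hφ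
  have e1 : ((‖φ z - φ u‖ ^ 2 : ℝ) : ℂ) = conj (φ z - φ u) * (φ z - φ u) := by
    rw [mul_comm, Complex.mul_conj, Complex.normSq_eq_norm_sq]
  have e2 : (1 - ‖a i‖ ^ 2) * ‖φ z - φ u‖ ^ 2 =
      ((1 - ‖a i‖ ^ 2 : ℝ) * (conj (φ z - φ u) * (φ z - φ u))).re := by
    rw [← e1, ← Complex.ofReal_mul, Complex.ofReal_re]
  change _ = _ + (1 - ‖a i‖ ^ 2) * ‖φ z - φ u‖ ^ 2
  rw [e2, kernelDistSq, kernelDistSq, ← Complex.add_re, key z hz z hz, key u hu z hz,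
    key z hz u hu, key u hu u hu]
  congr 1
  simp only [hφ, map_sub]
  ring

theorem norm_finiteBlaschke_le_one {ι : Type*} {a : ι → ℂ} (ha : IsBlaschkeSequence a)
    (s : Finset ι) {z : ℂ} (hz : z ∈ unitDisc) : ‖finiteBlaschke a s z‖ ≤ 1 := by
  rw [finiteBlaschke, norm_prod]
  exact Finset.prod_le_one (fun _ _ => norm_nonneg _)
    fun i _ => norm_blaschkeFactor_le_one (ha.1 i).1 (ha.1 i).2 hz

theorem kernelDistSq_finiteBlaschke_le {ι : Type*} {a : ι → ℂ} (ha : IsBlaschkeSequence a)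
    {z u : ℂ} (hz : z ∈ unitDisc) (hu : u ∈ unitDisc) {δ : ℝ} (hδ : 0 < δ) (hδ1 : δ ≤ 1)
    (hzδ : ∀ i, δ ≤ ‖1 - conj (a i) * z‖) (huδ : ∀ i, δ ≤ ‖1 - conj (a i) * u‖)
    (s : Finset ι) :
    kernelDistSq (modelKernel (finiteBlaschke a s)) z u ≤
      (2 * ∑ i ∈ s, (1 - ‖a i‖)) *
        ((2 * ∑' i, (1 - ‖a i‖) + 1) * ‖z - u‖ / δ ^ 3) ^ 2 := by
  classical
  set T := ∑' i, (1 - ‖a i‖) with hT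
  have hpos : ∀ i, 0 ≤ 1 - ‖a i‖ := fun i => sub_nonneg.2 (ha.1 i).2.le
  have hT0 : 0 ≤ T := tsum_nonneg hpos
  induction s using Finset.induction_on with
  | empty => simp [kernelDistSq, modelKernel, finiteBlaschke]
  | insert i s hi ih =>
    rw [kernelDistSq_modelKernel_insert (ha.1 i).1 (ha.1 i).2 hi hz hu, Finset.sum_insert hi]
    have hdiff : ‖finiteBlaschke a s z - finiteBlaschke a s u‖ ≤ 2 * T * ‖z - u‖ / δ ^ 2 := by
      refine (norm_prod_sub_prod_le s _ _
        (fun j => norm_blaschkeFactor_le_one (ha.1 j).1 (ha.1 j).2 hz)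
        (fun j => norm_blaschkeFactor_le_one (ha.1 j).1 (ha.1 j).2 hu)).trans ?_
      refine (Finset.sum_le_sum fun j _ => norm_blaschkeFactor_sub_le (ha.1 j).1 (ha.1 j).2 hδ
        (hzδ j) (huδ j)).trans ?_
      rw [← Finset.sum_div, ← Finset.sum_mul, ← Finset.mul_sum]
      gcongr
      exact ha.2.sum_le_tsum s fun j _ => hpos j
    have hsz : ‖szegoKernel (a i) z‖ ≤ 1 / δ := by
      rw [szegoKernel, norm_inv, one_div]
      exact inv_anti₀ hδ (hzδ i)
    have hE : ‖finiteBlaschke a s z * szegoKernel (a i) z -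
        finiteBlaschke a s u * szegoKernel (a i) u‖ ≤ (2 * T + 1) * ‖z - u‖ / δ ^ 3 := by
      calc _ = ‖(finiteBlaschke a s z - finiteBlaschke a s u) * szegoKernel (a i) z +
            finiteBlaschke a s u * (szegoKernel (a i) z - szegoKernel (a i) u)‖ := by
            congr 1; ring
        _ ≤ 2 * T * ‖z - u‖ / δ ^ 2 * (1 / δ) + 1 * (‖z - u‖ / δ ^ 2) := by
            refine (norm_add_le _ _).trans ?_
            rw [norm_mul, norm_mul]
            gcongr
            · exact norm_finiteBlaschke_le_one ha s hu
            · exact norm_szegoKernel_sub_le (ha.1 i).2 hδ (hzδ i) (huδ i)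
        _ ≤ 2 * T * ‖z - u‖ / δ ^ 2 * (1 / δ) + ‖z - u‖ / δ ^ 3 := by
            rw [one_mul]
            gcongr 2
            exact pow_le_pow_of_le_one hδ.le hδ1 (by norm_num)
        _ = _ := by field_simp
    have ha2 : 1 - ‖a i‖ ^ 2 ≤ 2 * (1 - ‖a i‖) := by nlinarith [hpos i]
    have ha3 : 0 ≤ 1 - ‖a i‖ ^ 2 := by nlinarith [hpos i, norm_nonneg (a i)]
    have := mul_le_mul ha2 (pow_le_pow_left₀ (norm_nonneg _) hE 2) (by positivity)
      (by linarith [hpos i])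
    linarith

theorem tendsto_finiteBlaschke {ι : Type*} {a : ι → ℂ} (ha : IsBlaschkeSequence a)
    {z : ℂ} (hz : z ∈ unitDisc) :
    Tendsto (fun s => finiteBlaschke a s z) atTop (𝓝 (blaschkeProduct a z)) :=
  (ha.multipliable hz).hasProd

theorem norm_blaschkeProduct_le_one {ι : Type*} {a : ι → ℂ} (ha : IsBlaschkeSequence a)
    {z : ℂ} (hz : z ∈ unitDisc) : ‖blaschkeProduct a z‖ ≤ 1 :=
  le_of_tendsto (tendsto_finiteBlaschke ha hz).norm
    (Eventually.of_forall fun s => norm_finiteBlaschke_le_one ha s hz)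

theorem differentiableOn_blaschkeFactor {a : ℂ} (h1 : ‖a‖ < 1) :
    DifferentiableOn ℂ (blaschkeFactor a) unitDisc := by
  intro z hz
  refine DifferentiableAt.differentiableWithinAt ?_
  unfold blaschkeFactor
  have hd : DifferentiableAt ℂ (fun w => (a - w) / (1 - conj a * w)) z :=
    DifferentiableAt.fun_div (by fun_prop) (by fun_prop)
      (one_sub_conj_mul_ne_zero h1 (mem_unitDisc.1 hz).le)
  exact hd.const_mul _

theorem differentiableOn_blaschkeProduct {ι : Type*} {a : ι → ℂ} (ha : IsBlaschkeSequence a) :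
    DifferentiableOn ℂ (blaschkeProduct a) unitDisc := by
  intro z hz
  obtain ⟨ρ, hzρ, hρ⟩ := exists_between (mem_unitDisc.1 hz)
  have hsub : Metric.ball (0 : ℂ) ρ ⊆ unitDisc := Metric.ball_subset_ball hρ.le
  have hloc := Summable.hasProdLocallyUniformlyOn_one_add (f := fun i w => blaschkeFactor (a i) w - 1)
    (K := Metric.ball (0 : ℂ) ρ) Metric.isOpen_ball (ha.2.mul_left (2 / (1 - ρ)))
    (Eventually.of_forall fun i w hw => by
      refine (norm_blaschkeFactor_sub_one_le (ha.1 i).1 (ha.1 i).2 (hsub hw)).trans ?_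
      have := mem_ball_zero_iff.1 hw
      have h1 := (ha.1 i).2
      gcongr)
    (fun i => ((differentiableOn_blaschkeFactor (ha.1 i).2).continuousOn.mono hsub).sub
      continuousOn_const)
  simp only [add_sub_cancel] at hloc
  have hd : DifferentiableOn ℂ (blaschkeProduct a) (Metric.ball (0 : ℂ) ρ) := by
    refine TendstoLocallyUniformlyOn.differentiableOn hloc (Eventually.of_forall fun s => ?_)
      Metric.isOpen_ball
    exact DifferentiableOn.fun_finsetProd
      fun i _ => (differentiableOn_blaschkeFactor (ha.1 i).2).mono hsub
  exact (hd.differentiableAt (Metric.isOpen_ball.mem_nhds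
    (mem_ball_zero_iff.2 hzρ))).differentiableWithinAt

/-- Lipschitz estimate for the kernels of the model space of a Blaschke product, at points
where all the denominators `1 - conj (a i) * z` of the factors have modulus at least `δ`. -/
theorem kernelDistSq_blaschkeProduct_le {ι : Type*} {a : ι → ℂ} (ha : IsBlaschkeSequence a)
    {z u : ℂ} (hz : z ∈ unitDisc) (hu : u ∈ unitDisc) {δ : ℝ} (hδ : 0 < δ) (hδ1 : δ ≤ 1)
    (hzδ : ∀ i, δ ≤ ‖1 - conj (a i) * z‖) (huδ : ∀ i, δ ≤ ‖1 - conj (a i) * u‖) :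
    kernelDistSq (modelKernel (blaschkeProduct a)) z u ≤
      ((2 * ∑' i, (1 - ‖a i‖) + 1) ^ 2 * ‖z - u‖ / δ ^ 3) ^ 2 := by
  set T := ∑' i, (1 - ‖a i‖) with hT
  have hpos : ∀ i, 0 ≤ 1 - ‖a i‖ := fun i => sub_nonneg.2 (ha.1 i).2.le
  have hT0 : 0 ≤ T := tsum_nonneg hpos
  have hK : ∀ v ∈ unitDisc, ∀ w ∈ unitDisc,
      Tendsto (fun s => modelKernel (finiteBlaschke a s) v w) atTop
        (𝓝 (modelKernel (blaschkeProduct a) v w)) := fun v hv w hw =>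
    (((((Complex.continuous_conj.tendsto _).comp (tendsto_finiteBlaschke ha hv)).mul
      (tendsto_finiteBlaschke ha hw)).const_sub 1).mul_const _)
  have hlim : Tendsto (fun s => kernelDistSq (modelKernel (finiteBlaschke a s)) z u) atTop
      (𝓝 (kernelDistSq (modelKernel (blaschkeProduct a)) z u)) :=
    (Complex.continuous_re.tendsto _).comp
      ((((hK z hz z hz).sub (hK u hu z hz)).sub (hK z hz u hu)).add (hK u hu u hu))
  refine le_of_tendsto hlim (Eventually.of_forall fun s => ?_)
  refine (kernelDistSq_finiteBlaschke_le ha hz hu hδ hδ1 hzδ huδ s).trans ?_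
  have hs : ∑ i ∈ s, (1 - ‖a i‖) ≤ T := ha.2.sum_le_tsum s fun j _ => hpos j
  calc _ ≤ (2 * T + 1) ^ 2 * ((2 * T + 1) * ‖z - u‖ / δ ^ 3) ^ 2 := by
        gcongr
        nlinarith
    _ = _ := by ring

/-! ### Derivatives in model spaces -/

/-- In the model space of a Blaschke product the derivative is bounded by the inverse cube of a
lower bound `δ` for the denominators `1 - conj (a i) * u` of the factors near `z`. -/
theorem norm_deriv_le_of_mem_modelSpace {ι : Type*} {a : ι → ℂ} (ha : IsBlaschkeSequence a)
    {f : ℂ → ℂ} (hf : f ∈ modelSpace (blaschkeProduct a)) {M : ℝ} (hM : 0 < M)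
    (hfM : ∀ r ∈ Ioo (0 : ℝ) 1, Real.circleAverage (fun z => ‖f z‖ ^ 2) 0 r ≤ M ^ 2)
    {z : ℂ} (hz : z ∈ unitDisc) {δ : ℝ} (hδ : 0 < δ) (hδ1 : δ ≤ 1)
    (hδz : ∀ᶠ u in 𝓝 z, ∀ i, δ ≤ ‖1 - conj (a i) * u‖) :
    ‖deriv f z‖ ≤ M * ((2 * ∑' i, (1 - ‖a i‖) + 1) ^ 2 / δ ^ 3) := by
  have hT0 : 0 ≤ ∑' i, (1 - ‖a i‖) := tsum_nonneg fun i => sub_nonneg.2 (ha.1 i).2.le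
  refine norm_deriv_le_of_lip' (by positivity) ?_
  filter_upwards [hδz, Metric.isOpen_ball.mem_nhds hz] with u hu hu1
  have hu1 : u ∈ unitDisc := hu1
  rcases eq_or_ne u z with rfl | huz
  · simp
  have hn : 0 < ‖u - z‖ := norm_pos_iff.2 (sub_ne_zero.2 huz)
  have h := norm_combination_le_of_mem_modelSpace (differentiableOn_blaschkeProduct ha)
    (fun w hw => norm_blaschkeProduct_le_one ha hw) hf hM
    (A := (2 * ∑' i, (1 - ‖a i‖) + 1) ^ 2 * ‖u - z‖ / δ ^ 3) (by positivity) hfM hu1 hz 1 (-1) ?_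
  · calc ‖f u - f z‖ = ‖conj (1 : ℂ) * f u + conj (-1 : ℂ) * f z‖ := by
          congr 1; simp; ring
      _ ≤ _ := h
      _ = _ := by ring
  · refine le_of_eq_of_le ?_
      (kernelDistSq_blaschkeProduct_le ha hu1 hz hδ hδ1 hu hδz.self_of_nhds)
    rw [kernelDistSq]
    congr 1
    simp only [map_one, map_neg]
    ring

/-- For `a` in a Stolz domain with vertex `ξ`, the denominator `1 - conj a * z` is at least a fixed
multiple of `|ξ - z|`, uniformly in `a`. -/
theorem norm_one_sub_le_of_mem_stolzDomain {a ξ z : ℂ} {η : ℝ} (hη : 0 ≤ η) (hξ : ‖ξ‖ = 1)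
    (ha : a ∈ stolzDomain η ξ) (hz : ‖z‖ ≤ 1) :
    ‖1 - conj ξ * z‖ ≤ (1 + η) * ‖1 - conj a * z‖ := by
  have h1 : ‖a - ξ‖ ≤ η * ‖1 - conj a * z‖ := by
    have hξ' : ξ * conj ξ = 1 := by
      rw [Complex.mul_conj, Complex.normSq_eq_norm_sq, hξ]; norm_num
    have : ‖a - ξ‖ = ‖1 - conj ξ * a‖ := by
      rw [← one_mul ‖1 - conj ξ * a‖, ← hξ, ← norm_mul, ← norm_neg]
      congr 1
      linear_combination a * hξ'
    rw [this]
    refine ha.2.trans ?_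
    gcongr
    exact one_sub_norm_le_norm_one_sub_conj_mul a hz
  calc ‖1 - conj ξ * z‖ = ‖(1 - conj a * z) + conj (a - ξ) * z‖ := by
        congr 1; rw [map_sub]; ring
    _ ≤ ‖1 - conj a * z‖ + ‖a - ξ‖ * ‖z‖ := by
        refine (norm_add_le _ _).trans ?_
        rw [norm_mul, RCLike.norm_conj]
    _ ≤ ‖1 - conj a * z‖ + ‖a - ξ‖ * 1 := by gcongr
    _ ≤ _ := by linarith

/-- If the zeros lie in a Stolz domain with vertex `ξ`, derivatives of functions in the model space
are `O(|ξ - z|⁻³)`. -/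
theorem norm_deriv_le_of_mem_stolzDomain {ι : Type*} {a : ι → ℂ} (ha : IsBlaschkeSequence a)
    {η : ℝ} {ξ : ℂ} (hη : 1 < η) (hξ : ‖ξ‖ = 1) (hS : ∀ i, a i ∈ stolzDomain η ξ)
    {f : ℂ → ℂ} (hf : f ∈ modelSpace (blaschkeProduct a)) {M : ℝ} (hM : 0 < M)
    (hfM : ∀ r ∈ Ioo (0 : ℝ) 1, Real.circleAverage (fun z => ‖f z‖ ^ 2) 0 r ≤ M ^ 2)
    {z : ℂ} (hz : z ∈ unitDisc) :
    ‖deriv f z‖ ≤ M * ((2 * ∑' i, (1 - ‖a i‖) + 1) ^ 2 * (2 * (1 + η)) ^ 3) /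
      ‖1 - conj ξ * z‖ ^ 3 := by
  have hz' := mem_unitDisc.1 hz
  have hd : 0 < ‖1 - conj ξ * z‖ := by
    have h := norm_sub_norm_le (1 : ℂ) (conj ξ * z)
    rw [norm_one, norm_mul, RCLike.norm_conj, hξ] at h
    linarith
  have hd2 : ‖1 - conj ξ * z‖ ≤ 2 := by
    have h := norm_sub_le (1 : ℂ) (conj ξ * z)
    rw [norm_one, norm_mul, RCLike.norm_conj, hξ] at h
    linarith
  -- half of the distance at `z` still is a lower bound for the distance at nearby points
  have h := norm_deriv_le_of_mem_modelSpace ha hf hM hfM hz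
    (δ := ‖1 - conj ξ * z‖ / (2 * (1 + η))) (by positivity)
    (by rw [div_le_one (by positivity)]; linarith) ?_
  · refine h.trans_eq ?_
    field_simp
  · have hcont : ContinuousAt (fun u => ‖1 - conj ξ * u‖) z := by fun_prop
    filter_upwards [hcont.eventually (lt_mem_nhds (half_lt_self hd)),
      Metric.isOpen_ball.mem_nhds hz] with u hu hu1 i
    have h1 := norm_one_sub_le_of_mem_stolzDomain (zero_le_one.trans hη.le) hξ (hS i)
      (mem_unitDisc.1 hu1).le
    rw [div_le_iff₀ (by positivity)]
    linarith

/-! ### An area integral over the disc -/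

theorem lintegral_Ioo_one_sub_rpow_lt_top {β : ℝ} (hβ : -1 < β) :
    ∫⁻ r in Ioo (0 : ℝ) 1, ENNReal.ofReal ((1 - r) ^ β) < ∞ := by
  have h : IntervalIntegrable (fun r : ℝ => (1 - r) ^ β) volume 0 1 := by
    have := (intervalIntegral.intervalIntegrable_rpow' (a := 1) (b := 0) hβ).comp_sub_left 1
    simpa using this
  rw [intervalIntegrable_iff_integrableOn_Ioo_of_le zero_le_one] at h
  exact h.lintegral_lt_top

theorem lintegral_Ioo_abs_rpow_lt_top {s b : ℝ} (hs : -1 < s) (hb : 0 ≤ b) :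
    ∫⁻ t in Ioo (-b) b, ENNReal.ofReal (|t| ^ s) < ∞ := by
  have h1 : IntervalIntegrable (fun t : ℝ => |t| ^ s) volume 0 b := by
    refine (intervalIntegral.intervalIntegrable_rpow' hs).congr fun t ht => ?_
    rw [uIoc_of_le hb] at ht
    simp only [abs_of_pos ht.1]
  have h2 : IntervalIntegrable (fun t : ℝ => |t| ^ s) volume (-b) 0 := by
    have := h1.comp_sub_left 0
    simpa using this.symm
  have h := h2.trans h1
  rw [intervalIntegrable_iff_integrableOn_Ioo_of_le (by linarith)] at h
  exact h.lintegral_lt_top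

theorem abs_div_pi_le_norm_one_sub_polar {r t : ℝ} (hr : r ∈ Ioo (0 : ℝ) 1)
    (ht : t ∈ Ioo (-Real.pi) Real.pi) :
    |t| / Real.pi ≤ ‖1 - (r : ℂ) * (Real.cos t + Real.sin t * Complex.I)‖ := by
  have hexp : (Real.cos t + Real.sin t * Complex.I : ℂ) = Complex.exp (t * Complex.I) := by
    rw [Complex.exp_mul_I]; push_cast; rfl
  rw [hexp]
  have hn : ‖Complex.exp (t * Complex.I)‖ = 1 := Complex.norm_exp_ofReal_mul_I t
  have h1 : 1 - r ≤ ‖1 - (r : ℂ) * Complex.exp (t * Complex.I)‖ := by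
    have h := norm_sub_norm_le (1 : ℂ) ((r : ℂ) * Complex.exp (t * Complex.I))
    rwa [norm_one, norm_mul, hn, Complex.norm_real, Real.norm_of_nonneg hr.1.le, mul_one] at h
  have h2 : ‖Complex.exp (t * Complex.I) - 1‖ ≤
      ‖1 - (r : ℂ) * Complex.exp (t * Complex.I)‖ + (1 - r) := by
    calc ‖Complex.exp (t * Complex.I) - 1‖
        = ‖-(1 - (r : ℂ) * Complex.exp (t * Complex.I)) +
            ((1 - r : ℝ) : ℂ) * Complex.exp (t * Complex.I)‖ := by
          congr 1; push_cast; ring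
      _ ≤ _ := by
          refine (norm_add_le _ _).trans ?_
          rw [norm_neg, norm_mul, hn, Complex.norm_real,
            Real.norm_of_nonneg (by linarith [hr.2]), mul_one]
  have h3 : 2 * (|t| / Real.pi) ≤ ‖Complex.exp (t * Complex.I) - 1‖ := by
    rw [mul_comm (t : ℂ), Complex.norm_exp_I_mul_ofReal_sub_one, norm_mul, Real.norm_two,
      Real.norm_eq_abs]
    have habs : |t / 2| ≤ Real.pi / 2 := by
      rw [abs_div, abs_two]
      have := abs_lt.2 ht
      linarith
    have := Real.mul_abs_le_abs_sin habs
    rw [abs_div, abs_two] at this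
    calc 2 * (|t| / Real.pi) = 2 * (2 / Real.pi * (|t| / 2)) := by ring
      _ ≤ _ := by gcongr
  linarith

/-- Since `|1 - r e^{it}|` is at least `|t| / π`, in polar coordinates the integrand is dominated by
a product of a function of the radius and a function of the angle. -/
theorem lintegral_unitDisc_norm_one_sub_rpow_lt_top {s β : ℝ} (hs0 : 0 < s) (hs1 : s < 1)
    (hβ : -1 < β) :
    ∫⁻ z in unitDisc, ENNReal.ofReal (‖1 - z‖ ^ (-s) * (1 - ‖z‖) ^ β) < ∞ := by
  rw [← lintegral_indicator (by exact measurableSet_ball),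
    ← Complex.lintegral_comp_polarCoord_symm]
  set μ := (volume.restrict (Ioo (0 : ℝ) 1)).prod (volume.restrict (Ioo (-Real.pi) Real.pi))
    with hμ
  set F : ℝ × ℝ → ℝ≥0∞ := fun q =>
    ENNReal.ofReal ((1 - q.1) ^ β) *
      (ENNReal.ofReal (Real.pi ^ s) * ENNReal.ofReal (|q.2| ^ (-s))) with hF
  have hFint : ∫⁻ q, F q ∂μ < ∞ := by
    rw [hμ, hF, lintegral_prod_mul (f := fun r : ℝ => ENNReal.ofReal ((1 - r) ^ β))
      (g := fun t : ℝ => ENNReal.ofReal (Real.pi ^ s) * ENNReal.ofReal (|t| ^ (-s)))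
      (by fun_prop) (by fun_prop), lintegral_const_mul _ (by fun_prop)]
    exact ENNReal.mul_lt_top (lintegral_Ioo_one_sub_rpow_lt_top hβ)
      (ENNReal.mul_lt_top ENNReal.ofReal_lt_top
        (lintegral_Ioo_abs_rpow_lt_top (by linarith) Real.pi_pos.le))
  refine lt_of_le_of_lt ?_ hFint
  rw [hμ, Measure.prod_restrict, ← Measure.volume_eq_prod,
    ← lintegral_indicator (polarCoord.open_target.measurableSet),
    ← lintegral_indicator (measurableSet_Ioo.prod measurableSet_Ioo)]
  -- the ray `t = 0` is discarded, because `0 ^ (-s) = 0` in the reals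
  have hne : ∀ᵐ q : ℝ × ℝ, q.2 ≠ 0 := by
    have h : ∀ᵐ t : ℝ, t ≠ 0 := by simp [ae_iff]
    exact Measure.quasiMeasurePreserving_snd.ae h
  refine lintegral_mono_ae ?_
  filter_upwards [hne] with q hq
  by_cases hqt : q ∈ polarCoord.target
  swap
  · rw [indicator_of_notMem (by exact hqt)]; exact zero_le
  rw [indicator_of_mem (by exact hqt)]
  have hq1 : 0 < q.1 := hqt.1
  have hq2 : q.2 ∈ Ioo (-Real.pi) Real.pi := hqt.2
  have hnorm : ‖Complex.polarCoord.symm q‖ = q.1 := by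
    rw [Complex.norm_polarCoord_symm, abs_of_pos hq1]
  by_cases hqU : q.1 < 1
  swap
  · rw [indicator_of_notMem (by rw [mem_unitDisc, hnorm]; exact hqU)]; simp
  rw [indicator_of_mem (by rw [mem_unitDisc, hnorm]; exact hqU),
    indicator_of_mem (show q ∈ Ioo (0 : ℝ) 1 ×ˢ Ioo (-Real.pi) Real.pi from ⟨⟨hq1, hqU⟩, hq2⟩),
    hnorm, smul_eq_mul]
  have hlow := abs_div_pi_le_norm_one_sub_polar ⟨hq1, hqU⟩ hq2
  rw [← Complex.polarCoord_symm_apply] at hlow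
  have habs : 0 < |q.2| := abs_pos.2 hq
  have hb : 0 ≤ (1 - q.1) ^ β := Real.rpow_nonneg (by linarith) _
  rw [hF]
  simp only
  rw [← ENNReal.ofReal_mul hq1.le, ← ENNReal.ofReal_mul (p := Real.pi ^ s) (by positivity),
    ← ENNReal.ofReal_mul hb]
  refine ENNReal.ofReal_le_ofReal ?_
  have h1 : ‖1 - Complex.polarCoord.symm q‖ ^ (-s) ≤ Real.pi ^ s * |q.2| ^ (-s) := by
    calc _ ≤ (|q.2| / Real.pi) ^ (-s) :=
          Real.rpow_le_rpow_of_nonpos (by positivity) hlow (by linarith)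
      _ = _ := by
          rw [Real.div_rpow habs.le Real.pi_pos.le, Real.rpow_neg Real.pi_pos.le, div_inv_eq_mul,
            mul_comm]
  calc _ ≤ 1 * (Real.pi ^ s * |q.2| ^ (-s) * (1 - q.1) ^ β) := by gcongr
    _ = _ := by ring

theorem lintegral_unitDisc_rpow_lt_top {ξ : ℂ} (hξ : ‖ξ‖ = 1) {s β : ℝ} (hs0 : 0 < s)
    (hs1 : s < 1) (hβ : -1 < β) :
    ∫⁻ z in unitDisc, ENNReal.ofReal (‖1 - conj ξ * z‖ ^ (-s) * (1 - ‖z‖) ^ β) < ∞ := by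
  have hc : ‖conj ξ‖ = 1 := by rw [RCLike.norm_conj, hξ]
  let e : ℂ ≃ₗᵢ[ℝ] ℂ := rotation ⟨conj ξ, mem_sphere_zero_iff_norm.2 hc⟩
  have he : ∀ z, e z = conj ξ * z := fun z => rfl
  have hemb : MeasurableEmbedding e := e.toHomeomorph.measurableEmbedding
  have hpre : e ⁻¹' unitDisc = unitDisc := by
    ext z
    simp [unitDisc]
  have h := e.measurePreserving.setLIntegral_comp_preimage_emb hemb
    (fun z => ENNReal.ofReal (‖1 - z‖ ^ (-s) * (1 - ‖z‖) ^ β)) unitDisc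
  rw [hpre] at h
  refine lt_of_le_of_lt (le_of_eq ?_) (lintegral_unitDisc_norm_one_sub_rpow_lt_top hs0 hs1 hβ)
  rw [← h]
  refine lintegral_congr fun z => ?_
  rw [LinearIsometryEquiv.norm_map, he]

/-! ### Membership in the Bergman space -/

/-- Weighted geometric mean of the two pointwise bounds `X ≤ C d⁻³` and `X ≤ C h^(-3/2)`. -/
theorem rpow_mul_rpow_le_of_le_of_le {X C d h p s α : ℝ} (hX : 0 ≤ X) (hC : 0 < C) (hd : 0 < d)
    (hh : 0 < h) (hs : 0 < s) (hsp : s < 3 * p) (h1 : X ≤ C * d ^ (-3 : ℝ))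
    (h2 : X ≤ C * h ^ (-(3 / 2) : ℝ)) :
    X ^ p * h ^ α ≤ C ^ p * (d ^ (-s) * h ^ (α - 3 / 2 * p + s / 2)) := by
  have e1 : X ^ (s / 3) ≤ C ^ (s / 3) * d ^ (-s) := by
    refine (Real.rpow_le_rpow hX h1 (by positivity)).trans_eq ?_
    rw [Real.mul_rpow hC.le (by positivity), ← Real.rpow_mul hd.le]
    congr 2
    ring
  have e2 : X ^ (p - s / 3) ≤ C ^ (p - s / 3) * h ^ (-(3 / 2) * p + s / 2) := by
    refine (Real.rpow_le_rpow hX h2 (by linarith)).trans_eq ?_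
    rw [Real.mul_rpow hC.le (by positivity), ← Real.rpow_mul hh.le]
    congr 2
    ring
  have e3 : X ^ p = X ^ (s / 3) * X ^ (p - s / 3) := by
    rw [← Real.rpow_add_of_nonneg hX (by positivity) (by linarith)]
    congr 1
    ring
  have e4 : C ^ p = C ^ (s / 3) * C ^ (p - s / 3) := by
    rw [← Real.rpow_add hC]
    congr 1
    ring
  have e5 : h ^ (α - 3 / 2 * p + s / 2) = h ^ (-(3 / 2) * p + s / 2) * h ^ α := by
    rw [← Real.rpow_add hh]
    congr 1
    ring
  rw [e3, e4, e5]
  calc _ ≤ (C ^ (s / 3) * d ^ (-s)) * (C ^ (p - s / 3) * h ^ (-(3 / 2) * p + s / 2)) * h ^ α := by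
        gcongr
    _ = _ := by ring

theorem theorem10 {ι : Type*} [Countable ι] (a : ι → ℂ) (ha : IsBlaschkeSequence a)
    (hStolz : ∃ (η : ℝ) (ξ : ℂ), 1 < η ∧ ‖ξ‖ = 1 ∧ ∀ i, a i ∈ stolzDomain η ξ)
    (α p : ℝ) (hα : -1 < α) (hp₀ : 0 < p) (hp : p < 1 + 2 / 3 * α) :
    ∀ f ∈ modelSpace (blaschkeProduct a), deriv f ∈ bergmanSpace p α := by
  intro f hf
  obtain ⟨η, ξ, hη, hξ, hS⟩ := hStolz
  refine ⟨hf.1.1.deriv Metric.isOpen_ball, ?_⟩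
  obtain ⟨M, hM, hfM⟩ := exists_circleAverage_sq_le hf.1
  obtain ⟨s, hs0, hs1⟩ : ∃ s, max 0 (3 * p - 2 - 2 * α) < s ∧ s < min 1 (3 * p) :=
    exists_between (max_lt (lt_min one_pos (by linarith)) (lt_min (by linarith) (by linarith)))
  rw [max_lt_iff] at hs0
  rw [lt_min_iff] at hs1
  set C := max (M * ((2 * ∑' i, (1 - ‖a i‖) + 1) ^ 2 * (2 * (1 + η)) ^ 3)) (4 * M) with hC
  have hC0 : 0 < C := lt_max_of_lt_right (by positivity)
  have hint := lintegral_unitDisc_rpow_lt_top hξ hs0.1 hs1.1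
    (β := α - 3 / 2 * p + s / 2) (by linarith [hs0.2])
  refine ENNReal.rpow_lt_top_of_nonneg (by positivity)
    (ENNReal.mul_lt_top ENNReal.ofReal_lt_top ?_).ne
  have hle : ∫⁻ z in unitDisc, ENNReal.ofReal (‖deriv f z‖ ^ p * (1 - ‖z‖) ^ α) ≤
      ∫⁻ z in unitDisc, ENNReal.ofReal (C ^ p) * ENNReal.ofReal
        (‖1 - conj ξ * z‖ ^ (-s) * (1 - ‖z‖) ^ (α - 3 / 2 * p + s / 2)) := by
    refine setLIntegral_mono' (by exact measurableSet_ball) fun z hz => ?_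
    have hz' := mem_unitDisc.1 hz
    have hd : 0 < ‖1 - conj ξ * z‖ := by
      have h := norm_sub_norm_le (1 : ℂ) (conj ξ * z)
      rw [norm_one, norm_mul, RCLike.norm_conj, hξ] at h
      linarith
    rw [← ENNReal.ofReal_mul (by positivity)]
    refine ENNReal.ofReal_le_ofReal (rpow_mul_rpow_le_of_le_of_le (norm_nonneg _) hC0 hd
      (sub_pos.2 hz') hs0.1 hs1.2 ?_ ?_)
    · refine (norm_deriv_le_of_mem_stolzDomain ha hη hξ hS hf hM hfM hz).trans ?_
      rw [Real.rpow_neg hd.le, ← div_eq_mul_inv]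
      norm_cast
      gcongr
      exact le_max_left _ _
    · have hB := differentiableOn_blaschkeProduct ha
      refine (norm_deriv_le_of_norm_le_rpow hf.1.1 hM (fun w hw => norm_le_of_mem_modelSpace hB
        (fun v hv => norm_blaschkeProduct_le_one ha hv) hf hM hfM hw) hz).trans ?_
      have hpos := sub_pos.2 hz'
      gcongr
      exact le_max_right _ _
  refine hle.trans_lt ?_
  rw [lintegral_const_mul' _ _ ENNReal.ofReal_ne_top]
  exact ENNReal.mul_lt_top ENNReal.ofReal_lt_top hint
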